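/- Let $G_1=\langle x_1\rangle$ and $G_2=\langle x_2\rangle$ be nontrivial finite cyclic groups of coprime orders, let $C_1=\langle c_1\rangle$ and $C_2=\langle c_2\rangle$ be infinite cyclic groups, and let $G=(G_1\times C_1)*(G_2\times C_2)$ be the free product. For $i=1,2$ let $F_i$ be the free group on two generators $X_i,Y_i$, and let $\varphi_i\colon F_i\twoheadrightarrow G_i\times C_i$ be the epimorphism with $X_i\mapsto (x_i,1)$ and $Y_i\mapsto (1,c_i)$. Let $F=F_1*F_2$, let $\varphi=\varphi_1*\varphi_2\colon F\twoheadrightarrow G$ be the induced epimorphism, and let $R=\ker\varphi$. Let $R'=[R,R]$ and regard the abelian group $R/R'$ as a $\mathbb{Z}G$-module, where $G\cong F/R$ acts by conjugation in $F$. Then the minimal number $d_G(R/R')$ of generators of $R/R'$ as a $\mathbb{Z}G$-module satisfies \[ d_G(R/R')=3 . \] -/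

import Mathlib

/-!
Relation modules of free presentations, and the free presentation of a free product
`(G₁ × C₁) * (G₂ × C₂)` built from two-generator presentations of the factors.
-/

namespace RelationModule

section General

variable {F G : Type*} [Group F] [Group G]

/-- Conjugation by elements of `F` on `R / R'`, where `R` is the kernel of `φ : F →* G`. -/
def conjAb (φ : F →* G) : F →* MulAut (Abelianization φ.ker) where
  toFun f := (MulAut.conjNormal (H := φ.ker) f).abelianizationCongr
  map_one' := by
    ext x
    induction x using QuotientGroup.induction_on with
    | H r => rw [map_one]; rfl
  map_mul' f₁ f₂ := by
    ext x
    induction x using QuotientGroup.induction_on with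
    | H r => rw [map_mul]; rfl

theorem conjAb_of (φ : F →* G) (f : F) (r : φ.ker) :
    conjAb φ f (Abelianization.of r) = Abelianization.of (MulAut.conjNormal f r) :=
  rfl

/-- The kernel `R` acts trivially on `R / R'`. -/
theorem ker_le_ker_conjAb (φ : F →* G) : φ.ker ≤ (conjAb φ).ker := by
  intro s hs
  rw [MonoidHom.mem_ker]
  ext x
  induction x using QuotientGroup.induction_on with
  | H r =>
    have h : MulAut.conjNormal s r = (⟨s, hs⟩ : φ.ker) * r * (⟨s, hs⟩ : φ.ker)⁻¹ := by
      ext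
      simp
    change Abelianization.of (MulAut.conjNormal s r) = Abelianization.of r
    rw [h, map_mul, map_mul, map_inv, mul_comm, inv_mul_cancel_left]

/-- For a surjection `φ : F →* G` with kernel `R`, the action of `G` on `R / R'` induced by
conjugation in `F`. -/
noncomputable def action (φ : F →* G) (hφ : Function.Surjective φ) :
    G →* MulAut (Abelianization φ.ker) :=
  φ.liftOfSurjective hφ ⟨conjAb φ, ker_le_ker_conjAb φ⟩

theorem action_apply_of (φ : F →* G) (hφ : Function.Surjective φ) (f : F) (r : φ.ker) :
    action φ hφ (φ f) (Abelianization.of r) = Abelianization.of (MulAut.conjNormal f r) := by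
  have h : action φ hφ (φ f) = conjAb φ f :=
    φ.liftOfRightInverse_comp_apply _ (Function.rightInverse_surjInv hφ)
      ⟨conjAb φ, ker_le_ker_conjAb φ⟩ f
  rw [h, conjAb_of]

/-- The abelian group `R / R'`, written additively, as an integral representation of `G`. -/
noncomputable def rep (φ : F →* G) (hφ : Function.Surjective φ) :
    Representation ℤ G (Additive (Abelianization φ.ker)) where
  toFun g := (MonoidHom.toAdditive (action φ hφ g).toMonoidHom).toIntLinearMap
  map_one' := by
    ext x
    simp
  map_mul' g₁ g₂ := by
    ext x
    simp

theorem rep_apply_of (φ : F →* G) (hφ : Function.Surjective φ) (f : F) (r : φ.ker) :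
    rep φ hφ (φ f) (Additive.ofMul (Abelianization.of r)) =
      Additive.ofMul (Abelianization.of (MulAut.conjNormal f r)) :=
  congrArg Additive.ofMul (action_apply_of φ hφ f r)

/-- `d_G(R / R')`: the minimal number of generators of the relation module `R / R'` as a module
over the integral group ring `ℤ[G]`. -/
noncomputable def minGenerators (φ : F →* G) (hφ : Function.Surjective φ) : Cardinal :=
  (⊤ : Submodule (MonoidAlgebra ℤ G) (rep φ hφ).asModule).spanRank

end General

section Presentation

/-- The two-generator presentation of `A × C` given by `x ∈ A` and `c ∈ C`: the free group of
rank two is mapped to `A × C` by sending the free generators to `(x, 1)` and `(1, c)`. -/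
def factorHom {A C : Type*} [Group A] [Group C] (x : A) (c : C) : FreeGroup (Fin 2) →* A × C :=
  FreeGroup.lift ![(x, 1), (1, c)]

theorem factorHom_surjective {A C : Type*} [Group A] [Group C] {x : A} {c : C}
    (hx : Subgroup.zpowers x = ⊤) (hc : Subgroup.zpowers c = ⊤) :
    Function.Surjective (factorHom x c) := by
  rintro ⟨a, b⟩
  obtain ⟨m, rfl⟩ := Subgroup.mem_zpowers_iff.1 (hx ▸ Subgroup.mem_top a)
  obtain ⟨n, rfl⟩ := Subgroup.mem_zpowers_iff.1 (hc ▸ Subgroup.mem_top b)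
  exact ⟨FreeGroup.of 0 ^ m * FreeGroup.of 1 ^ n, by simp [factorHom]⟩

theorem coprodMap_surjective {F₁ F₂ H₁ H₂ : Type*} [Group F₁] [Group F₂] [Group H₁] [Group H₂]
    {φ₁ : F₁ →* H₁} {φ₂ : F₂ →* H₂}
    (h₁ : Function.Surjective φ₁) (h₂ : Function.Surjective φ₂) :
    Function.Surjective (Monoid.Coprod.map φ₁ φ₂) := by
  intro y
  induction y using Monoid.Coprod.induction_on with
  | inl a =>
    obtain ⟨f, rfl⟩ := h₁ a
    exact ⟨Monoid.Coprod.inl f, by simp⟩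
  | inr b =>
    obtain ⟨f, rfl⟩ := h₂ b
    exact ⟨Monoid.Coprod.inr f, by simp⟩
  | mul a b ha hb =>
    obtain ⟨u, rfl⟩ := ha
    obtain ⟨v, rfl⟩ := hb
    exact ⟨u * v, map_mul _ _ _⟩

end Presentation

end RelationModule

/-! Write `n`, `m` for the orders of `G₁`, `G₂`. As a module, `R/R'` is generated by the classes
`ρᵢ` of the power relators and `κᵢ` of the commutator relators, with `(xᵢ - 1)ρᵢ = 0` and `(cᵢ -
1)ρᵢ = Nᵢκᵢ`, where `Nᵢ` is the norm element of `Gᵢ`.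

Upper bound: by coprimality `1 + qn = ms`. Modulo `κ₁ - qρ₁`, `ρ₂ + (m - N₂)κ₂` and `κ₂ + ρ₁`, the
unit `c₁` multiplies `ρ₁` by `ms`, while `m²` kills `κ₂ = -ρ₁`; so `c₁²ρ₁ = 0` and all four classes
vanish (`generators_mem`).

Lower bound: for a prime `p` dividing `n`, a conjugation-invariant map from `R` onto `(ZMod p)³`
detects `ρ₁`, `ρ₂`, `κ₁` (`rank_le_minGenerators`). Two coordinates are divided exponent sums; the
third is the corner entry of a Heisenberg representation, which sends `R` into the centre. -/

namespace RelationModule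

/-! ### Module algebra: three elements generate four relators. -/

/-- Modulo three suitable combinations of them, the four relators of the two factors vanish. Here `ρᵢ`
stands for the power relator and `κᵢ` for the commutator relator; modulo `κ₁ - q ρ₁` the unit `c₁`
acts on `ρ₁` as a multiple of `m`, while `m ^ 2` kills `κ₂ = -ρ₁`. -/
theorem generators_eq_zero {A M : Type*} [Ring A] [AddCommGroup M] [Module A M]
    {n m : ℕ} {q s : ℤ} (hq : 1 + q * n = m * s)
    {x₁ c₁ d₁ x₂ c₂ : A} (hd : d₁ * c₁ = 1) (hx₂ : x₂ ^ m = 1) {ρ₁ κ₁ ρ₂ κ₂ : M}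
    (h₁ : x₁ • ρ₁ = ρ₁) (h₁' : c₁ • ρ₁ = (∑ i ∈ Finset.range n, x₁ ^ i) • κ₁ + ρ₁)
    (h₂ : x₂ • ρ₂ = ρ₂) (h₂' : c₂ • ρ₂ = (∑ i ∈ Finset.range m, x₂ ^ i) • κ₂ + ρ₂)
    (w₁ : κ₁ - q • ρ₁ = 0)
    (w₂ : ρ₂ + (m • κ₂ - (∑ i ∈ Finset.range m, x₂ ^ i) • κ₂) = 0)
    (w₃ : κ₂ + ρ₁ = 0) : ρ₁ = 0 ∧ κ₁ = 0 ∧ ρ₂ = 0 ∧ κ₂ = 0 := by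
  have sum_smul_of_fixed : ∀ {x : A} {v : M} (k : ℕ), x • v = v →
      (∑ i ∈ Finset.range k, x ^ i) • v = k • v := by
    intro x v k h
    have hp : ∀ i : ℕ, x ^ i • v = v := by
      intro i
      induction i with
      | zero => simp
      | succ i ih => rw [pow_succ, mul_smul, h, ih]
    simp [Finset.sum_smul, hp]
  set N₂ := ∑ i ∈ Finset.range m, x₂ ^ i with hN₂
  have hxN : x₂ * N₂ = N₂ := by
    have h := mul_geom_sum x₂ m
    rw [hx₂, sub_self, sub_mul, one_mul, sub_eq_zero] at h
    exact h
  have hNN : N₂ • (N₂ • κ₂) = m • (N₂ • κ₂) :=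
    sum_smul_of_fixed m (by rw [← mul_smul, hxN])
  -- `mρ₂ = N₂ρ₂ = -N₂(m - N₂)κ₂`, which vanishes because `N₂² = mN₂`.
  have hmρ : m • ρ₂ = 0 := by
    rw [← sum_smul_of_fixed m h₂, eq_neg_of_add_eq_zero_left w₂, smul_neg, smul_sub, hNN,
      smul_comm, sub_self, neg_zero]
  -- `N₂κ₂ = (c₂ - 1)ρ₂`, and `m` kills `ρ₂`.
  have hmN : m • (N₂ • κ₂) = 0 := by
    rw [← add_sub_cancel_right (N₂ • κ₂) ρ₂, ← h₂', smul_sub, smul_comm, hmρ, smul_zero, sub_zero]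
  have hmm : m • (m • κ₂) = 0 := by
    have h : m • (ρ₂ + (m • κ₂ - N₂ • κ₂)) = 0 := by rw [w₂, smul_zero]
    rwa [smul_add, smul_sub, hmρ, hmN, zero_add, sub_zero] at h
  have hmmρ : m • (m • ρ₁) = 0 := by
    rw [eq_neg_of_add_eq_zero_right w₃, smul_neg, smul_neg, hmm, neg_zero]
  -- With `κ₁ = qρ₁` and `N₁ρ₁ = nρ₁`, `c₁` acts on `ρ₁` as `1 + qn = ms`.
  have hc : c₁ • ρ₁ = s • (m • ρ₁) := by
    rw [h₁', sub_eq_zero.1 w₁, smul_comm, sum_smul_of_fixed n h₁]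
    have : (1 + q * n) • ρ₁ = (m * s : ℤ) • ρ₁ := by rw [hq]
    rw [← natCast_zsmul, ← natCast_zsmul, smul_smul, smul_smul, mul_comm s, ← this, add_smul,
      one_smul, add_comm]
  have hcc : c₁ • (c₁ • ρ₁) = 0 := by
    rw [hc, smul_comm, smul_comm c₁ m, hc, smul_comm m s (m • ρ₁), hmmρ, smul_zero, smul_zero]
  have hρ₁ : ρ₁ = 0 := by
    have h : d₁ • d₁ • c₁ • c₁ • ρ₁ = 0 := by rw [hcc, smul_zero, smul_zero]
    rwa [smul_smul d₁ c₁, hd, one_smul, smul_smul, hd, one_smul] at h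
  have hκ₂ : κ₂ = 0 := by simpa [hρ₁] using w₃
  exact ⟨hρ₁, by simpa [hρ₁] using w₁, by simpa [hκ₂] using w₂, hκ₂⟩

/-- The submodule form of `generators_eq_zero`. -/
theorem generators_mem {A M : Type*} [Ring A] [AddCommGroup M] [Module A M] (W : Submodule A M)
    {n m : ℕ} {q s : ℤ} (hq : 1 + q * n = m * s)
    {x₁ c₁ d₁ x₂ c₂ : A} (hd : d₁ * c₁ = 1) (hx₂ : x₂ ^ m = 1) {ρ₁ κ₁ ρ₂ κ₂ : M}
    (h₁ : x₁ • ρ₁ = ρ₁) (h₁' : c₁ • ρ₁ = (∑ i ∈ Finset.range n, x₁ ^ i) • κ₁ + ρ₁)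
    (h₂ : x₂ • ρ₂ = ρ₂) (h₂' : c₂ • ρ₂ = (∑ i ∈ Finset.range m, x₂ ^ i) • κ₂ + ρ₂)
    (w₁ : κ₁ - q • ρ₁ ∈ W)
    (w₂ : ρ₂ + (m • κ₂ - (∑ i ∈ Finset.range m, x₂ ^ i) • κ₂) ∈ W)
    (w₃ : κ₂ + ρ₁ ∈ W) : ρ₁ ∈ W ∧ κ₁ ∈ W ∧ ρ₂ ∈ W ∧ κ₂ ∈ W := by
  simp only [← Submodule.Quotient.mk_eq_zero W, ← Submodule.mkQ_apply] at w₁ w₂ w₃ ⊢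
  refine generators_eq_zero hq hd hx₂ (x₁ := x₁) (c₂ := c₂) ?_ ?_ ?_ ?_ ?_ ?_ ?_
  · rw [← map_smul, h₁]
  · rw [← map_smul, ← map_smul, ← map_add, h₁']
  · rw [← map_smul, h₂]
  · rw [← map_smul, ← map_smul, ← map_add, h₂']
  · rw [← map_zsmul, ← map_sub, w₁]
  · rw [← map_nsmul, ← map_smul, ← map_sub, ← map_add, w₂]
  · rw [← map_add, w₃]

/-! ### Calculus of classes in the relation module. -/

section General

variable {F G : Type*} [Group F] [Group G]

/-- The class in `R / R'` of an element of the kernel `R`. -/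
noncomputable def cls (φ : F →* G) (hφ : Function.Surjective φ) (r : φ.ker) :
    (rep φ hφ).asModule :=
  (rep φ hφ).asModuleEquiv.symm (Additive.ofMul (Abelianization.of r))

theorem cls_mul (φ : F →* G) (hφ : Function.Surjective φ) (r s : φ.ker) :
    cls φ hφ (r * s) = cls φ hφ r + cls φ hφ s := by
  simp [cls]

theorem cls_one (φ : F →* G) (hφ : Function.Surjective φ) : cls φ hφ 1 = 0 := by
  simp [cls]

theorem cls_inv (φ : F →* G) (hφ : Function.Surjective φ) (r : φ.ker) :
    cls φ hφ r⁻¹ = -cls φ hφ r :=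
  rfl

theorem of_smul_cls (φ : F →* G) (hφ : Function.Surjective φ) (f : F) (r : φ.ker) :
    MonoidAlgebra.of ℤ G (φ f) • cls φ hφ r = cls φ hφ (MulAut.conjNormal f r) := by
  rw [cls, ← Representation.asModuleEquiv_symm_map_rho, rep_apply_of]
  rfl

theorem cls_surjective (φ : F →* G) (hφ : Function.Surjective φ) :
    Function.Surjective (cls φ hφ) := fun v => by
  obtain ⟨r, hr⟩ := QuotientGroup.mk_surjective ((rep φ hφ).asModuleEquiv v).toMul
  exact ⟨r, hr⟩

/-- A submodule of `R / R'` containing the classes of a set of normal generators of `R`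
is everything. -/
theorem eq_top_of_ker_le_normalClosure (φ : F →* G) (hφ : Function.Surjective φ) {S : Set F}
    (hS : φ.ker ≤ Subgroup.normalClosure S)
    (W : Submodule (MonoidAlgebra ℤ G) (rep φ hφ).asModule)
    (hW : ∀ s ∈ S, ∃ h : s ∈ φ.ker, cls φ hφ ⟨s, h⟩ ∈ W) : W = ⊤ := by
  -- The elements of `R` with class in `W` form a normal subgroup of `F`, as `W` is stable under
  -- `G`.
  let K : Subgroup F :=
    { carrier := {f | ∃ h : f ∈ φ.ker, cls φ hφ ⟨f, h⟩ ∈ W}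
      one_mem' := ⟨one_mem _, by
        change cls φ hφ 1 ∈ W
        rw [cls_one]
        exact W.zero_mem⟩
      mul_mem' := by
        rintro a b ⟨ha, ha'⟩ ⟨hb, hb'⟩
        refine ⟨mul_mem ha hb, ?_⟩
        change cls φ hφ (⟨a, ha⟩ * ⟨b, hb⟩) ∈ W
        rw [cls_mul]
        exact W.add_mem ha' hb'
      inv_mem' := by
        rintro a ⟨ha, ha'⟩
        refine ⟨inv_mem ha, ?_⟩
        change cls φ hφ (⟨a, ha⟩⁻¹) ∈ W
        rw [cls_inv]
        exact W.neg_mem ha' }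
  have hK : K.Normal := ⟨by
    rintro a ⟨ha, ha'⟩ f
    refine ⟨φ.normal_ker.conj_mem a ha f, ?_⟩
    have h := W.smul_mem (MonoidAlgebra.of ℤ G (φ f)) ha'
    rwa [of_smul_cls] at h⟩
  have hle : φ.ker ≤ K := hS.trans (Subgroup.normalClosure_le_normal hW)
  refine eq_top_iff.2 fun v _ => ?_
  obtain ⟨r, rfl⟩ := cls_surjective φ hφ v
  exact (hle r.2).2

/-- `(c - 1) xⁿ = (1 + x + ⋯ + xⁿ⁻¹) [c, x]` in `R / R'`. -/
theorem of_smul_cls_pow (φ : F →* G) (hφ : Function.Surjective φ) (x c : F) (n : ℕ)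
    (hx : x ^ n ∈ φ.ker) (hk : c * x * c⁻¹ * x⁻¹ ∈ φ.ker) :
    MonoidAlgebra.of ℤ G (φ c) • cls φ hφ ⟨x ^ n, hx⟩ =
      (∑ i ∈ Finset.range n, MonoidAlgebra.of ℤ G (φ x) ^ i) •
        cls φ hφ ⟨c * x * c⁻¹ * x⁻¹, hk⟩ + cls φ hφ ⟨x ^ n, hx⟩ := by
  -- Induction via `[c, xᵏ⁺¹] = [c, xᵏ] · xᵏ[c, x]x⁻ᵏ`.
  have key : ∀ k : ℕ, ∃ h : c * x ^ k * c⁻¹ * (x ^ k)⁻¹ ∈ φ.ker,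
      cls φ hφ ⟨_, h⟩ = (∑ i ∈ Finset.range k, MonoidAlgebra.of ℤ G (φ x) ^ i) •
        cls φ hφ ⟨c * x * c⁻¹ * x⁻¹, hk⟩ := by
    intro k
    induction k with
    | zero =>
      refine ⟨by simp, ?_⟩
      rw [Finset.sum_range_zero, zero_smul, ← cls_one φ hφ]
      congr 1
      ext
      simp
    | succ k ih =>
      obtain ⟨h, ih⟩ := ih
      have e : c * x ^ (k + 1) * c⁻¹ * (x ^ (k + 1))⁻¹ =
          ((⟨_, h⟩ : φ.ker) * MulAut.conjNormal (x ^ k) (⟨_, hk⟩ : φ.ker) : φ.ker) := by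
        simp only [Subgroup.coe_mul, MulAut.conjNormal_apply]
        group
      refine ⟨e ▸ Subtype.property _, ?_⟩
      rw [Finset.sum_range_succ, add_smul, ← ih, ← map_pow, ← map_pow, of_smul_cls, ← cls_mul]
      congr 1
      exact Subtype.ext e
  obtain ⟨h, hn⟩ := key n
  rw [of_smul_cls, ← hn, ← cls_mul]
  congr 1
  ext
  simp

theorem of_smul_cls_pow_self (φ : F →* G) (hφ : Function.Surjective φ) (x : F) (n : ℕ)
    (hx : x ^ n ∈ φ.ker) :
    MonoidAlgebra.of ℤ G (φ x) • cls φ hφ ⟨x ^ n, hx⟩ = cls φ hφ ⟨x ^ n, hx⟩ := by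
  rw [of_smul_cls]
  congr 1
  ext
  rw [MulAut.conjNormal_apply, ← pow_succ', pow_succ, mul_inv_cancel_right]

/-- A conjugation-invariant homomorphism from `R` whose image spans a vector space `V` bounds the
number of generators of `R / R'` from below by the dimension of `V`. -/
theorem rank_le_minGenerators {F : Type} [Group F] {k V : Type} [Field k] [AddCommGroup V]
    [Module k V] (φ : F →* G) (hφ : Function.Surjective φ) (ψ : φ.ker →* Multiplicative V)
    (hψ : ∀ f r, ψ (MulAut.conjNormal f r) = ψ r)
    (hV : Submodule.span k (Set.range fun r => (ψ r).toAdd) = ⊤) :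
    Module.rank k V ≤ minGenerators φ hφ := by
  obtain ⟨S, hS, hspan⟩ :=
    (⊤ : Submodule (MonoidAlgebra ℤ G) (rep φ hφ).asModule).exists_span_set_card_eq_spanRank
  let θ : (rep φ hφ).asModule →+ V :=
    (MonoidHom.toAdditiveLeft (Abelianization.lift ψ)).comp
      (rep φ hφ).asModuleEquiv.toLinearMap.toAddMonoidHom
  have hθ : ∀ r, θ (cls φ hφ r) = (ψ r).toAdd := fun r => rfl
  have hg : ∀ (g : G) v, θ (MonoidAlgebra.of ℤ G g • v) = θ v := by
    intro g v
    obtain ⟨f, rfl⟩ := hφ g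
    obtain ⟨r, rfl⟩ := cls_surjective φ hφ v
    rw [of_smul_cls, hθ, hθ, hψ]
  -- Since `θ` is `G`-invariant, it turns `ℤ[G]`-combinations into integral ones.
  have hmem : ∀ v, θ v ∈ Submodule.span k (θ '' S) := by
    intro v
    have hv : v ∈ Submodule.span (MonoidAlgebra ℤ G) S := hspan ▸ Submodule.mem_top
    induction hv using Submodule.span_induction with
    | mem v hv => exact Submodule.subset_span ⟨v, hv, rfl⟩
    | zero => rw [map_zero]; exact zero_mem _
    | add v w _ _ hv hw => rw [map_add]; exact add_mem hv hw
    | smul a v _ hv =>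
      induction a using MonoidAlgebra.induction_on with
      | of g => rwa [hg]
      | add a b ha hb => rw [add_smul, map_add]; exact add_mem ha hb
      | smul t a ha => rw [smul_assoc, map_zsmul]; exact zsmul_mem ha t
  have htop : Submodule.span k (θ '' S) = ⊤ := by
    rw [eq_top_iff, ← hV, Submodule.span_le]
    rintro _ ⟨r, rfl⟩
    exact hmem (cls φ hφ r)
  calc Module.rank k V = Module.rank k (Submodule.span k (θ '' S)) := by rw [htop, rank_top]
    _ ≤ Cardinal.mk (θ '' S) := rank_span_le _
    _ ≤ Cardinal.mk S := Cardinal.mk_image_le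
    _ = minGenerators φ hφ := hS

end General

/-! ### Normal generators of the kernel. -/

/-- A homomorphism on the free group of rank two that kills the relators `xⁿ` and `[c, x]`, with
`n` the order of `x`, factors through `factorHom x c`. -/
theorem exists_comp_factorHom_eq {A C Q : Type*} [Group A] [Group C] [Infinite C] [Group Q]
    {x : A} {c : C} (hx : Subgroup.zpowers x = ⊤) (hc : Subgroup.zpowers c = ⊤)
    (u : FreeGroup (Fin 2) →* Q) (hu : u (FreeGroup.of 0 ^ Nat.card A) = 1)
    (hu' : u (FreeGroup.of 1 * FreeGroup.of 0 * (FreeGroup.of 1)⁻¹ * (FreeGroup.of 0)⁻¹) = 1) :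
    ∃ h : A × C →* Q, h.comp (factorHom x c) = u := by
  have hx' : ∀ a, a ∈ Subgroup.zpowers x := fun a => hx ▸ Subgroup.mem_top a
  have hc' : ∀ a, a ∈ Subgroup.zpowers c := fun a => hc ▸ Subgroup.mem_top a
  have ox : orderOf (u (FreeGroup.of 0)) ∣ orderOf x := by
    rw [orderOf_eq_card_of_zpowers_eq_top hx]
    exact orderOf_dvd_of_pow_eq_one (by rw [← map_pow, hu])
  have oc : orderOf (u (FreeGroup.of 1)) ∣ orderOf c := by
    rw [orderOf_eq_card_of_zpowers_eq_top hc, Nat.card_eq_zero_of_infinite]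
    exact dvd_zero _
  have hcomm : Commute (u (FreeGroup.of 0)) (u (FreeGroup.of 1)) := by
    simp only [map_mul, map_inv] at hu'
    exact (mul_inv_eq_iff_eq_mul.1 (mul_inv_eq_one.1 hu')).symm
  let α := monoidHomOfForallMemZpowers hx' ox
  let β := monoidHomOfForallMemZpowers hc' oc
  have hα : α x = u (FreeGroup.of 0) := monoidHomOfForallMemZpowers_apply_gen hx' ox
  have hβ : β c = u (FreeGroup.of 1) := monoidHomOfForallMemZpowers_apply_gen hc' oc
  have hαβ : ∀ a b, Commute (α a) (β b) := by
    intro a b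
    obtain ⟨i, rfl⟩ := Subgroup.mem_zpowers_iff.1 (hx' a)
    obtain ⟨j, rfl⟩ := Subgroup.mem_zpowers_iff.1 (hc' b)
    rw [map_zpow, map_zpow, hα, hβ]
    exact (hcomm.zpow_left i).zpow_right j
  refine ⟨α.noncommCoprod β hαβ, ?_⟩
  ext i
  fin_cases i <;> simp [factorHom, hα, hβ]

/-- The kernel of `φ₁ * φ₂` is normally generated by the images of any elements whose vanishing
makes homomorphisms factor through `φ₁` and `φ₂`. -/
theorem ker_coprodMap_le_normalClosure {F₁ F₂ H₁ H₂ : Type*} [Group F₁] [Group F₂] [Group H₁]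
    [Group H₂] (φ₁ : F₁ →* H₁) (φ₂ : F₂ →* H₂) (S : Set (Monoid.Coprod F₁ F₂))
    (h₁ : ∃ h : H₁ →* Monoid.Coprod F₁ F₂ ⧸ Subgroup.normalClosure S,
      h.comp φ₁ = (QuotientGroup.mk' _).comp Monoid.Coprod.inl)
    (h₂ : ∃ h : H₂ →* Monoid.Coprod F₁ F₂ ⧸ Subgroup.normalClosure S,
      h.comp φ₂ = (QuotientGroup.mk' _).comp Monoid.Coprod.inr) :
    (Monoid.Coprod.map φ₁ φ₂).ker ≤ Subgroup.normalClosure S := by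
  obtain ⟨h₁, e₁⟩ := h₁
  obtain ⟨h₂, e₂⟩ := h₂
  -- The quotient map by the normal closure factors through `φ₁ * φ₂`, so it kills the kernel.
  have h : (Monoid.Coprod.lift h₁ h₂).comp (Monoid.Coprod.map φ₁ φ₂) = QuotientGroup.mk' _ := by
    apply Monoid.Coprod.hom_ext
    · rw [← e₁]; ext; simp
    · rw [← e₂]; ext; simp
  intro f hf
  rw [← QuotientGroup.ker_mk' (Subgroup.normalClosure S), MonoidHom.mem_ker, ← h,
    MonoidHom.comp_apply, MonoidHom.mem_ker.1 hf, map_one]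

/-! ### The Heisenberg group and divisibility of exponent sums. -/

/-- The Heisenberg group over a commutative ring: upper unitriangular `3 × 3` matrices. -/
@[ext]
structure Heisenberg (k : Type*) where
  /-- The first entry above the diagonal. -/
  a : k
  /-- The second entry above the diagonal. -/
  b : k
  /-- The corner entry. -/
  z : k

namespace Heisenberg

variable {k : Type*} [CommRing k]

instance : One (Heisenberg k) := ⟨⟨0, 0, 0⟩⟩
instance : Mul (Heisenberg k) := ⟨fun s t => ⟨s.a + t.a, s.b + t.b, s.z + t.z + s.a * t.b⟩⟩
instance : Inv (Heisenberg k) := ⟨fun s => ⟨-s.a, -s.b, -s.z + s.a * s.b⟩⟩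

@[simp] theorem one_a : (1 : Heisenberg k).a = 0 := rfl
@[simp] theorem one_b : (1 : Heisenberg k).b = 0 := rfl
@[simp] theorem one_z : (1 : Heisenberg k).z = 0 := rfl
@[simp] theorem mul_a (s t : Heisenberg k) : (s * t).a = s.a + t.a := rfl
@[simp] theorem mul_b (s t : Heisenberg k) : (s * t).b = s.b + t.b := rfl
@[simp] theorem mul_z (s t : Heisenberg k) : (s * t).z = s.z + t.z + s.a * t.b := rfl
@[simp] theorem inv_a (s : Heisenberg k) : s⁻¹.a = -s.a := rfl
@[simp] theorem inv_b (s : Heisenberg k) : s⁻¹.b = -s.b := rfl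
@[simp] theorem inv_z (s : Heisenberg k) : s⁻¹.z = -s.z + s.a * s.b := rfl

instance : Group (Heisenberg k) :=
  Group.ofLeftAxioms (fun s t u => by ext <;> simp <;> ring) (fun s => by ext <;> simp)
    (fun s => by ext <;> simp)

/-- The first entry above the diagonal, as a homomorphism. -/
def aHom : Heisenberg k →* Multiplicative k where
  toFun s := Multiplicative.ofAdd s.a
  map_one' := rfl
  map_mul' _ _ := rfl

/-- The second entry above the diagonal, as a homomorphism. -/
def bHom : Heisenberg k →* Multiplicative k where
  toFun s := Multiplicative.ofAdd s.b
  map_one' := rfl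
  map_mul' _ _ := rfl

theorem pow_z_of_b_eq_zero {s : Heisenberg k} (hz : s.z = 0) (hb : s.b = 0) (n : ℕ) :
    (s ^ n).z = 0 := by
  induction n with
  | zero => rfl
  | succ n ih => rw [pow_succ, mul_z, ih, hz, hb, mul_zero, add_zero, add_zero]

end Heisenberg

/-- `g ^ e(r)` depends only on `φ r`. If `g` has infinite order, then `orderOf g = 0` and the
divisibility says that `e` vanishes on the kernel. -/
theorem orderOf_dvd_of_zpowersHom_comp_eq {F G H : Type*} [Group F] [Group G] [Group H]
    {φ : F →* G} {e : F →* Multiplicative ℤ} {g : H} {η : G →* H}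
    (h : (zpowersHom H g).comp e = η.comp φ) {r : F} (hr : r ∈ φ.ker) :
    (orderOf g : ℤ) ∣ (e r).toAdd := by
  have h' := DFunLike.congr_fun h r
  rw [MonoidHom.comp_apply, MonoidHom.comp_apply, MonoidHom.mem_ker.1 hr, map_one] at h'
  exact orderOf_dvd_iff_zpow_eq_one.2 h'

/-! ### The two bounds for the free product. -/

section Factors

variable {G₁ G₂ C₁ C₂ : Type*} [Group G₁] [Group G₂] [Group C₁] [Group C₂]

theorem inl_pow_mem_ker (x₁ : G₁) (c₁ : C₁) (x₂ : G₂) (c₂ : C₂) :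
    Monoid.Coprod.inl (FreeGroup.of 0) ^ Nat.card G₁ ∈
      (Monoid.Coprod.map (factorHom x₁ c₁) (factorHom x₂ c₂)).ker := by
  rw [MonoidHom.mem_ker, map_pow, Monoid.Coprod.map_apply_inl, ← map_pow]
  simp [factorHom, ← Prod.one_eq_mk]

theorem inr_pow_mem_ker (x₁ : G₁) (c₁ : C₁) (x₂ : G₂) (c₂ : C₂) :
    Monoid.Coprod.inr (FreeGroup.of 0) ^ Nat.card G₂ ∈
      (Monoid.Coprod.map (factorHom x₁ c₁) (factorHom x₂ c₂)).ker := by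
  rw [MonoidHom.mem_ker, map_pow, Monoid.Coprod.map_apply_inr, ← map_pow]
  simp [factorHom, ← Prod.one_eq_mk]

theorem inl_comm_mem_ker (x₁ : G₁) (c₁ : C₁) (x₂ : G₂) (c₂ : C₂) :
    Monoid.Coprod.inl (FreeGroup.of 1) * Monoid.Coprod.inl (FreeGroup.of 0) *
      (Monoid.Coprod.inl (FreeGroup.of 1))⁻¹ * (Monoid.Coprod.inl (FreeGroup.of 0))⁻¹ ∈
      (Monoid.Coprod.map (factorHom x₁ c₁) (factorHom x₂ c₂)).ker := by
  simp only [MonoidHom.mem_ker, map_mul, map_inv, Monoid.Coprod.map_apply_inl]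
  simp only [← map_mul, ← map_inv]
  simp [factorHom, ← Prod.one_eq_mk]

theorem inr_comm_mem_ker (x₁ : G₁) (c₁ : C₁) (x₂ : G₂) (c₂ : C₂) :
    Monoid.Coprod.inr (FreeGroup.of 1) * Monoid.Coprod.inr (FreeGroup.of 0) *
      (Monoid.Coprod.inr (FreeGroup.of 1))⁻¹ * (Monoid.Coprod.inr (FreeGroup.of 0))⁻¹ ∈
      (Monoid.Coprod.map (factorHom x₁ c₁) (factorHom x₂ c₂)).ker := by
  simp only [MonoidHom.mem_ker, map_mul, map_inv, Monoid.Coprod.map_apply_inr]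
  simp only [← map_mul, ← map_inv]
  simp [factorHom, ← Prod.one_eq_mk]

theorem minGenerators_le_three [Infinite C₁] [Infinite C₂]
    (hcop : (Nat.card G₁).Coprime (Nat.card G₂))
    {x₁ : G₁} (hx₁ : Subgroup.zpowers x₁ = ⊤) {c₁ : C₁} (hc₁ : Subgroup.zpowers c₁ = ⊤)
    {x₂ : G₂} (hx₂ : Subgroup.zpowers x₂ = ⊤) {c₂ : C₂} (hc₂ : Subgroup.zpowers c₂ = ⊤)
    (hφ : Function.Surjective (Monoid.Coprod.map (factorHom x₁ c₁) (factorHom x₂ c₂))) :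
    minGenerators _ hφ ≤ 3 := by
  classical
  set φ := Monoid.Coprod.map (factorHom x₁ c₁) (factorHom x₂ c₂) with hφ_def
  have hρ₁ := inl_pow_mem_ker x₁ c₁ x₂ c₂
  have hρ₂ := inr_pow_mem_ker x₁ c₁ x₂ c₂
  have hκ₁ := inl_comm_mem_ker x₁ c₁ x₂ c₂
  have hκ₂ := inr_comm_mem_ker x₁ c₁ x₂ c₂
  rw [← hφ_def] at hρ₁ hρ₂ hκ₁ hκ₂
  set m := Nat.card G₂ with hm
  set n := Nat.card G₁ with hn
  obtain ⟨q, s, hq⟩ : ∃ q s : ℤ, 1 + q * n = m * s := by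
    obtain ⟨a, b, h⟩ := Nat.isCoprime_iff_coprime.2 hcop
    exact ⟨-a, b, by linarith⟩
  set X₁ : Monoid.Coprod (FreeGroup (Fin 2)) (FreeGroup (Fin 2)) :=
    Monoid.Coprod.inl (FreeGroup.of 0) with hX₁
  set Y₁ : Monoid.Coprod (FreeGroup (Fin 2)) (FreeGroup (Fin 2)) :=
    Monoid.Coprod.inl (FreeGroup.of 1) with hY₁
  set X₂ : Monoid.Coprod (FreeGroup (Fin 2)) (FreeGroup (Fin 2)) :=
    Monoid.Coprod.inr (FreeGroup.of 0) with hX₂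
  set Y₂ : Monoid.Coprod (FreeGroup (Fin 2)) (FreeGroup (Fin 2)) :=
    Monoid.Coprod.inr (FreeGroup.of 1) with hY₂
  set ρ₁ := cls φ hφ ⟨_, hρ₁⟩ with hρ₁_def
  set ρ₂ := cls φ hφ ⟨_, hρ₂⟩ with hρ₂_def
  set κ₁ := cls φ hφ ⟨_, hκ₁⟩ with hκ₁_def
  set κ₂ := cls φ hφ ⟨_, hκ₂⟩ with hκ₂_def
  let N₂ := ∑ i ∈ Finset.range m, MonoidAlgebra.of ℤ _ (φ X₂) ^ i
  let T : Finset (rep φ hφ).asModule :=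
    {κ₁ - q • ρ₁, ρ₂ + (m • κ₂ - N₂ • κ₂), κ₂ + ρ₁}
  let W := Submodule.span (MonoidAlgebra ℤ (Monoid.Coprod (G₁ × C₁) (G₂ × C₂)))
    (T : Set (rep φ hφ).asModule)
  have hT : ∀ w ∈ T, w ∈ W := fun w hw => Submodule.subset_span hw
  have hd : MonoidAlgebra.of ℤ _ (φ Y₁)⁻¹ * MonoidAlgebra.of ℤ _ (φ Y₁) = 1 := by
    rw [← map_mul, inv_mul_cancel, map_one]
  have hp : MonoidAlgebra.of ℤ _ (φ X₂) ^ m = 1 := by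
    rw [← map_pow, ← map_pow, MonoidHom.mem_ker.1 hρ₂, map_one]
  obtain ⟨z₁, z₂, z₃, z₄⟩ := generators_mem W hq hd hp
    (of_smul_cls_pow_self φ hφ X₁ n hρ₁) (of_smul_cls_pow φ hφ X₁ Y₁ n hρ₁ hκ₁)
    (of_smul_cls_pow_self φ hφ X₂ m hρ₂) (of_smul_cls_pow φ hφ X₂ Y₂ m hρ₂ hκ₂)
    (hT _ (by simp [T, κ₁, ρ₁])) (hT _ (by simp [T, N₂, ρ₂, κ₂])) (hT _ (by simp [T, κ₂, ρ₁]))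
  have hker : φ.ker ≤ Subgroup.normalClosure
      {X₁ ^ n, Y₁ * X₁ * Y₁⁻¹ * X₁⁻¹, X₂ ^ m, Y₂ * X₂ * Y₂⁻¹ * X₂⁻¹} := by
    refine ker_coprodMap_le_normalClosure _ _ _ (exists_comp_factorHom_eq hx₁ hc₁ _ ?_ ?_)
      (exists_comp_factorHom_eq hx₂ hc₂ _ ?_ ?_) <;>
    · rw [MonoidHom.comp_apply, QuotientGroup.mk'_apply, QuotientGroup.eq_one_iff]
      exact Subgroup.subset_normalClosure (by simp [X₁, X₂, Y₁, Y₂, n, m])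
  have hW : W = ⊤ := by
    refine eq_top_of_ker_le_normalClosure φ hφ hker W ?_
    rintro _ (rfl | rfl | rfl | rfl)
    exacts [⟨_, z₁⟩, ⟨_, z₂⟩, ⟨_, z₃⟩, ⟨_, z₄⟩]
  calc minGenerators φ hφ = W.spanRank := by rw [hW]; rfl
    _ ≤ Cardinal.mk (T : Set (rep φ hφ).asModule) := Submodule.spanRank_span_le_card _
    _ = (T.card : Cardinal) := by simp
    _ ≤ 3 := by exact_mod_cast Finset.card_le_three

theorem three_le_minGenerators [Finite G₁] [Finite G₂] [Nontrivial G₁] [Infinite C₁]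
    {x₁ : G₁} (hx₁ : Subgroup.zpowers x₁ = ⊤) {c₁ : C₁} (hc₁ : Subgroup.zpowers c₁ = ⊤)
    {x₂ : G₂} (hx₂ : Subgroup.zpowers x₂ = ⊤) {c₂ : C₂}
    (hφ : Function.Surjective (Monoid.Coprod.map (factorHom x₁ c₁) (factorHom x₂ c₂))) :
    3 ≤ minGenerators _ hφ := by
  have hρ₁ := inl_pow_mem_ker x₁ c₁ x₂ c₂
  have hρ₂ := inr_pow_mem_ker x₁ c₁ x₂ c₂
  have hκ₁ := inl_comm_mem_ker x₁ c₁ x₂ c₂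
  set φ := Monoid.Coprod.map (factorHom x₁ c₁) (factorHom x₂ c₂) with hφ_def
  have hn0 : (Nat.card G₁ : ℤ) ≠ 0 := by exact_mod_cast Nat.card_pos.ne'
  have hm0 : (Nat.card G₂ : ℤ) ≠ 0 := by exact_mod_cast Nat.card_pos.ne'
  obtain ⟨p, hp, hpn⟩ := Nat.exists_prime_and_dvd (Finite.one_lt_card (α := G₁)).ne'
  have : Fact p.Prime := ⟨hp⟩
  -- `ε` and `δ` are the exponent sums in the two free generators; `e₁`, `d₁`, `e₂` extend them
  -- trivially over the other factor.
  let ε : FreeGroup (Fin 2) →* Multiplicative ℤ := FreeGroup.lift ![Multiplicative.ofAdd 1, 1]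
  let δ : FreeGroup (Fin 2) →* Multiplicative ℤ := FreeGroup.lift ![1, Multiplicative.ofAdd 1]
  let e₁ : Monoid.Coprod (FreeGroup (Fin 2)) (FreeGroup (Fin 2)) →* Multiplicative ℤ :=
    Monoid.Coprod.lift ε 1
  let d₁ : Monoid.Coprod (FreeGroup (Fin 2)) (FreeGroup (Fin 2)) →* Multiplicative ℤ :=
    Monoid.Coprod.lift δ 1
  let e₂ : Monoid.Coprod (FreeGroup (Fin 2)) (FreeGroup (Fin 2)) →* Multiplicative ℤ :=
    Monoid.Coprod.lift 1 ε
  let h : Monoid.Coprod (FreeGroup (Fin 2)) (FreeGroup (Fin 2)) →* Heisenberg (ZMod p) :=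
    Monoid.Coprod.lift (FreeGroup.lift ![⟨1, 0, 0⟩, ⟨0, 1, 0⟩]) 1
  have he₁ : ∀ r ∈ φ.ker, (Nat.card G₁ : ℤ) ∣ (e₁ r).toAdd := by
    intro r hr
    rw [← orderOf_eq_card_of_zpowers_eq_top hx₁]
    refine orderOf_dvd_of_zpowersHom_comp_eq (e := e₁)
      (η := Monoid.Coprod.lift (MonoidHom.fst _ _) 1) ?_ hr
    apply Monoid.Coprod.hom_ext <;> ext i <;> fin_cases i <;> simp [e₁, ε, φ, factorHom]
  have he₂ : ∀ r ∈ φ.ker, (Nat.card G₂ : ℤ) ∣ (e₂ r).toAdd := by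
    intro r hr
    rw [← orderOf_eq_card_of_zpowers_eq_top hx₂]
    refine orderOf_dvd_of_zpowersHom_comp_eq (e := e₂)
      (η := Monoid.Coprod.lift 1 (MonoidHom.fst _ _)) ?_ hr
    apply Monoid.Coprod.hom_ext <;> ext i <;> fin_cases i <;> simp [e₂, ε, φ, factorHom]
  have hd₁ : ∀ r ∈ φ.ker, (d₁ r).toAdd = 0 := by
    intro r hr
    have hc : orderOf c₁ = 0 := by
      rw [orderOf_eq_card_of_zpowers_eq_top hc₁, Nat.card_eq_zero_of_infinite]
    rw [← zero_dvd_iff, ← Nat.cast_zero, ← hc]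
    refine orderOf_dvd_of_zpowersHom_comp_eq (e := d₁)
      (η := Monoid.Coprod.lift (MonoidHom.snd _ _) 1) ?_ hr
    apply Monoid.Coprod.hom_ext <;> ext i <;> fin_cases i <;> simp [d₁, δ, φ, factorHom]
  let cast : Multiplicative ℤ →* Multiplicative (ZMod p) :=
    (Int.castAddHom (ZMod p)).toMultiplicative
  have ha : ∀ r ∈ φ.ker, (h r).a = 0 := by
    intro r hr
    have hcomp : Heisenberg.aHom.comp h = cast.comp e₁ := by
      apply Monoid.Coprod.hom_ext <;> ext i <;> fin_cases i <;>
        simp [h, e₁, ε, cast, Heisenberg.aHom]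
    have hr' : (h r).a = ((e₁ r).toAdd : ZMod p) :=
      congrArg Multiplicative.toAdd (DFunLike.congr_fun hcomp r)
    rw [hr', ZMod.intCast_zmod_eq_zero_iff_dvd]
    exact (Int.natCast_dvd_natCast.2 hpn).trans (he₁ r hr)
  have hb : ∀ r ∈ φ.ker, (h r).b = 0 := by
    intro r hr
    have hcomp : Heisenberg.bHom.comp h = cast.comp d₁ := by
      apply Monoid.Coprod.hom_ext <;> ext i <;> fin_cases i <;>
        simp [h, d₁, δ, cast, Heisenberg.bHom]
    have hr' : (h r).b = ((d₁ r).toAdd : ZMod p) :=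
      congrArg Multiplicative.toAdd (DFunLike.congr_fun hcomp r)
    rw [hr', hd₁ r hr, Int.cast_zero]
  -- Exponent sums are divided over `ℤ` before reduction, so `p` need not divide `Nat.card G₂`. The
  -- corner entry is additive on `R` because `a` vanishes there.
  let ψ : φ.ker →* Multiplicative (Fin 3 → ZMod p) := MonoidHom.mk'
    (fun r => Multiplicative.ofAdd ![(((e₁ r).toAdd / Nat.card G₁ : ℤ) : ZMod p),
      (((e₂ r).toAdd / Nat.card G₂ : ℤ) : ZMod p), (h r).z]) (by
    intro r s
    rw [← ofAdd_add]
    simp only [Subgroup.coe_mul, map_mul, toAdd_mul, Int.add_ediv_of_dvd_left (he₁ r r.2),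
      Int.add_ediv_of_dvd_left (he₂ r r.2), Heisenberg.mul_z, ha r r.2, Int.cast_add]
    simp)
  have hψ : ∀ r, (ψ r).toAdd = ![(((e₁ r).toAdd / Nat.card G₁ : ℤ) : ZMod p),
      (((e₂ r).toAdd / Nat.card G₂ : ℤ) : ZMod p), (h r).z] := fun r => rfl
  have hrank := rank_le_minGenerators (k := ZMod p) φ hφ ψ (by
    intro f r
    apply Multiplicative.toAdd.injective
    rw [hψ, hψ, MulAut.conjNormal_apply]
    simp only [map_mul, map_inv, toAdd_mul, toAdd_inv, add_neg_cancel_comm]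
    congr 3
    -- With `a = b = 0`, `h r` is central, so conjugation fixes its corner entry.
    simp only [Heisenberg.mul_z, Heisenberg.mul_a, Heisenberg.inv_z, Heisenberg.inv_b, ha r r.2,
      hb r r.2]
    ring) (by
    have h₀ : ψ ⟨_, hρ₁⟩ = Multiplicative.ofAdd ![1, 0, 0] := by
      apply Multiplicative.toAdd.injective
      rw [hψ]
      have hz := Heisenberg.pow_z_of_b_eq_zero (k := ZMod p) (s := ⟨1, 0, 0⟩) rfl rfl
        (Nat.card G₁)
      ext i
      fin_cases i <;> simp [e₁, e₂, h, ε, Int.ediv_self hn0, hz]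
    have h₁ : ψ ⟨_, hρ₂⟩ = Multiplicative.ofAdd ![0, 1, 0] := by
      apply Multiplicative.toAdd.injective
      rw [hψ]
      ext i
      fin_cases i <;> simp [e₁, e₂, h, ε, Int.ediv_self hm0]
    -- The sign arises because the relator is `[Y₁, X₁]`, not `[X₁, Y₁]`.
    have h₂ : ψ ⟨_, hκ₁⟩ = Multiplicative.ofAdd ![0, 0, -1] := by
      apply Multiplicative.toAdd.injective
      rw [hψ]
      ext i
      fin_cases i <;> simp [e₁, e₂, h, ε]
    rw [eq_top_iff]
    intro v _
    have hv : v = v 0 • ![1, 0, 0] + v 1 • ![0, 1, 0] + (-v 2) • ![0, 0, -1] := by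
      ext i; fin_cases i <;> simp
    rw [hv]
    exact add_mem (add_mem
      (Submodule.smul_mem _ _ (Submodule.subset_span ⟨_, congrArg Multiplicative.toAdd h₀⟩))
      (Submodule.smul_mem _ _ (Submodule.subset_span ⟨_, congrArg Multiplicative.toAdd h₁⟩)))
      (Submodule.smul_mem _ _ (Submodule.subset_span ⟨_, congrArg Multiplicative.toAdd h₂⟩)))
  simpa using hrank

end Factors

end RelationModule

theorem proposition1p2 {G₁ G₂ C₁ C₂ : Type*} [Group G₁] [Group G₂] [Group C₁] [Group C₂]
    [Finite G₁] [Finite G₂] [Nontrivial G₁] [Nontrivial G₂] [Infinite C₁] [Infinite C₂]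
    (hcop : (Nat.card G₁).Coprime (Nat.card G₂))
    (x₁ : G₁) (hx₁ : Subgroup.zpowers x₁ = ⊤) (c₁ : C₁) (hc₁ : Subgroup.zpowers c₁ = ⊤)
    (x₂ : G₂) (hx₂ : Subgroup.zpowers x₂ = ⊤) (c₂ : C₂) (hc₂ : Subgroup.zpowers c₂ = ⊤) :
    RelationModule.minGenerators
      (Monoid.Coprod.map (RelationModule.factorHom x₁ c₁) (RelationModule.factorHom x₂ c₂))
      (RelationModule.coprodMap_surjective
        (RelationModule.factorHom_surjective hx₁ hc₁)
        (RelationModule.factorHom_surjective hx₂ hc₂)) = 3 :=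
  le_antisymm (RelationModule.minGenerators_le_three hcop hx₁ hc₁ hx₂ hc₂ _)
    (RelationModule.three_le_minGenerators hx₁ hc₁ hx₂ _)
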